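/- A *quantaloid* is a category $\mathcal Q$ whose hom-sets are complete lattices and whose composition preserves arbitrary joins in each variable; for $u:p\to q$, $w:p\to r$ write $w\swarrow u:q\to r$ for the largest $v$ with $v\circ u\le w$. It is *involutive* if it carries maps $(-)^\circ:\mathcal Q(p,q)\to\mathcal Q(q,p)$ that preserve joins and satisfy $1_q^\circ=1_q$, $(v\circ u)^\circ=u^\circ\circ v^\circ$, $u^{\circ\circ}=u$. Let $\mathcal Q$ be a small involutive quantaloid with object set $\mathcal Q_0$. A *$\mathcal Q$-category* is a set $X$ with a type map $|\cdot|:X\to\mathcal Q_0$ and arrows $\alpha(x,y)\in\mathcal Q(|x|,|y|)$ such that $1_{|x|}\le\alpha(x,x)$ and $\alpha(y,z)\circ\alpha(x,y)\le\alpha(x,z)$. A *$\mathcal Q$-functor* $f:(X,\alpha)\to(Y,\beta)$ is a map with $|fx|=|x|$ and $\alpha(x,x')\le\beta(fx,fx')$. Write $x\le y$ if $|x|=|y|$ and $1_{|x|}\le\alpha(x,y)$; $X$ is *separated* if $x\le y\le x$ implies $x=y$. $\mathcal Q$-functors $f:X\to Y$, $g:Y\to X$ are *adjoint*, $f\dashv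 g$, if $x\le gfx$ and $fgy\le y$ for all $x,y$. $X$ is *symmetric* if $\alpha(x,y)=\alpha(y,x)^\circ$; the *symmetrization* $X_{\mathsf s}$ of $X$ has the same typed set and hom $\alpha(x,y)\wedge\alpha(y,x)^\circ$. A *presheaf* of type $q$ on $X$ is a family $\mu(x)\in\mathcal Q(|x|,q)$ with $\mu(x)\circ\alpha(x',x)\le\mu(x')$; presheaves form a $\mathcal Q$-category $\mathsf PX$ with hom $(\mu,\mu')\mapsto\bigwedge_x\mu'(x)\swarrow\mu(x)$. $X$ is *complete* if the Yoneda embedding $\mathsf y_X:X\to\mathsf PX$, $x\mapsto\alpha(-,x)$, has a left adjoint $\sup_X$. Let $\mathcal Q\text{-}\mathbf{SymCat}$ be the category of symmetric $\mathcal Q$-categories and $\mathcal Q$-functors, $\mathcal Q\text{-}\mathbf{Sup}$ the category of separated complete $\mathcal Q$-categories and left adjoint $\mathcal Q$-functors, and $\mathfrak U_{\mathsf s}:\mathcal Q\text{-}\mathbf{Sup}\to\mathcal Q\text{-}\mathbf{SymCat}$ the functor $X\mapsto X_{\mathsf s}$, $f\mapsto f$. It has the left adjoint $\mathfrak P_{\mathsf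 s}:X\mapsto\mathsf PX$, $f\mapsto f^\to$, where $(f^\to\mu)(y)=\bigvee_x\mu(x)\circ\beta(y,fx)$. **Theorem.** (1) The right adjoint functor $\mathfrak U_{\mathsf s}:\mathcal Q\text{-}\mathbf{Sup}\to\mathcal Q\text{-}\mathbf{SymCat}$ is strictly monadic, that is, the canonical comparison functor from $\mathcal Q\text{-}\mathbf{Sup}$ to the Eilenberg–Moore category of the induced monad is an isomorphism of categories. Hence $\mathcal Q\text{-}\mathbf{Sup}$ is isomorphic to the Eilenberg–Moore category of the monad $\mathbb P_{\mathsf s}$ on $\mathcal Q\text{-}\mathbf{SymCat}$ induced by $\mathfrak P_{\mathsf s}\dashv\mathfrak U_{\mathsf s}$; this monad sends $X$ to $(\mathsf PX)_{\mathsf s}$ and $f$ to $f^\to$, has unit $\mathsf y_X$, and has multiplication $\Phi\mapsto\bigvee_{\mu\in\mathsf PX}\Phi(\mu)\circ\mu$. (2) Let $\mathsf V=(\mathsf V,\&,k,{}^\circ)$ be an involutive quantale (a one-object involutive quantaloid), with $p\,\&\,q\le r\iff p\le r/q\iff q\le p\backslash r$. Let $\mathbf D_*(\mathsf V)$ be the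 involutive quantaloid whose objects are the $q\in\mathsf V$ with $q^\circ=q$, whose arrows $p\to q$ are the $d\in\mathsf V$ with $d\le p\wedge q$ and $(d/p)\,\&\,p=d=q\,\&\,(q\backslash d)$, with composition $e\circ d=(e/q)\,\&\,d$ for $d:p\to q$, $e:q\to r$, identities $1_q=q$, and order and involution inherited from $\mathsf V$. A $\mathsf V$-*set* is a symmetric $\mathbf D_*(\mathsf V)$-category. Then $\mathfrak U_{\mathsf s}:\mathbf D_*(\mathsf V)\text{-}\mathbf{Sup}\to\mathsf V\text{-}\mathbf{Set}$ is strictly monadic, and $\mathbf D_*(\mathsf V)\text{-}\mathbf{Sup}$ is isomorphic to the Eilenberg–Moore category of the $\mathsf V$-powerset monad $\mathbb P_{\mathsf s}$ on $\mathsf V$-sets. Explicitly, the elements of $\mathsf P_{\mathsf s}(X,\alpha)$ are exactly the potential $\mathsf V$-subsets: pairs $(\mu,q)$, $\mu:X\to\mathsf V$, $q^\circ=q\in\mathsf V$, with $\mu(x)\le\alpha(x,x)\wedge q$, $(\mu(x)/\alpha(x,x))\,\&\,\alpha(x,x)=\mu(x)=q\,\&\,(q\backslash\mu(x))$ and $(\mu(y)/\alpha(y,y))\,\&\,\alpha(x,y)=\mu(y)\,\&\,(\alpha(y,y)\backslash\alpha(x,y))\le\mu(x)$;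 a map $f:(X,\alpha)\to(Y,\beta)$ acts by $(\mu,q)\mapsto(\lambda,q)$ with $\lambda(y)=\bigvee_x(\mu(x)/\alpha(x,x))\,\&\,\beta(y,fx)$; the unit is $x\mapsto(\alpha(-,x),\alpha(x,x))$; and the multiplication is $(\Phi,p)\mapsto\big(\bigvee_{(\mu,q)}(\Phi(\mu,q)/q)\,\&\,\mu,\;p\big)$. -/

import Mathlib

open CategoryTheory

universe u

namespace QEnriched

/-- A small quantaloid: a small category whose hom-sets are complete lattices and whose
composition preserves arbitrary joins in each variable. -/
class Quantaloid (Q : Type u) extends Category.{u} Q where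
  homLattice : ∀ p q : Q, CompleteLattice (p ⟶ q)
  sSup_comp : ∀ {p q r : Q} (S : Set (p ⟶ q)) (v : q ⟶ r), sSup S ≫ v = ⨆ u ∈ S, u ≫ v
  comp_sSup : ∀ {p q r : Q} (u : p ⟶ q) (S : Set (q ⟶ r)), u ≫ sSup S = ⨆ v ∈ S, u ≫ v

attribute [reducible, instance] Quantaloid.homLattice

/-- A small involutive quantaloid: `dag` is the action on arrows of an identity-on-objects,
join-preserving, contravariant, involutive functor. -/
class InvolutiveQuantaloid (Q : Type u) extends Quantaloid Q where
  dag : ∀ {p q : Q}, (p ⟶ q) → (q ⟶ p)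
  dag_id : ∀ q : Q, dag (𝟙 q) = 𝟙 q
  dag_comp : ∀ {p q r : Q} (u : p ⟶ q) (v : q ⟶ r), dag (u ≫ v) = dag v ≫ dag u
  dag_dag : ∀ {p q : Q} (u : p ⟶ q), dag (dag u) = u
  dag_sSup : ∀ {p q : Q} (S : Set (p ⟶ q)), dag (sSup S) = ⨆ u ∈ S, dag u

section Basic

variable {Q : Type u} [Quantaloid Q]

theorem iSup_comp {ι : Sort*} {p q r : Q} (f : ι → (p ⟶ q)) (v : q ⟶ r) :
    (⨆ i, f i) ≫ v = ⨆ i, f i ≫ v := by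
  rw [iSup, Quantaloid.sSup_comp, iSup_range]

theorem comp_iSup {ι : Sort*} {p q r : Q} (u : p ⟶ q) (f : ι → (q ⟶ r)) :
    u ≫ (⨆ i, f i) = ⨆ i, u ≫ f i := by
  rw [iSup, Quantaloid.comp_sSup, iSup_range]

theorem comp_mono {p q r : Q} {u u' : p ⟶ q} {v v' : q ⟶ r} (hu : u ≤ u') (hv : v ≤ v') :
    u ≫ v ≤ u' ≫ v' := by
  have h1 : u ≫ v ≤ u' ≫ v := by
    have : u' = sSup {u, u'} := by rw [sSup_pair, sup_eq_right.2 hu]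
    rw [this, Quantaloid.sSup_comp]
    exact le_iSup₂_of_le u (by simp) le_rfl
  have h2 : u' ≫ v ≤ u' ≫ v' := by
    have : v' = sSup {v, v'} := by rw [sSup_pair, sup_eq_right.2 hv]
    rw [this, Quantaloid.comp_sSup]
    exact le_iSup₂_of_le v (by simp) le_rfl
  exact h1.trans h2

/-- The left implication `w ↙ u : q ⟶ r` of `u : p ⟶ q` and `w : p ⟶ r`: the largest `v` with
`v ∘ u ≤ w`. -/
def limp {p q r : Q} (w : p ⟶ r) (u : p ⟶ q) : q ⟶ r := sSup {v | u ≫ v ≤ w}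

theorem le_limp {p q r : Q} {w : p ⟶ r} {u : p ⟶ q} {v : q ⟶ r} :
    v ≤ limp w u ↔ u ≫ v ≤ w := by
  constructor
  · intro h
    refine (comp_mono le_rfl h).trans ?_
    rw [limp, Quantaloid.comp_sSup]
    exact iSup₂_le fun _ hv => hv
  · exact fun h => le_sSup h

end Basic

/-- A `Q`-category: a set with a type map to the objects of `Q` and `Q`-valued homs. -/
structure QCat (Q : Type u) [Quantaloid Q] where
  carrier : Type u
  type : carrier → Q
  hom : ∀ x y : carrier, type x ⟶ type y
  id_le : ∀ x, 𝟙 (type x) ≤ hom x x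
  comp_le : ∀ x y z, hom x y ≫ hom y z ≤ hom x z

/-- A `Q`-functor: a type-preserving map with `α(x,x') ≤ β(fx,fx')`. The arrows `eqToHom _` are
identities of `Q`; they only record `|fx| = |x|`. -/
@[ext]
structure QFunctor {Q : Type u} [Quantaloid Q] (X Y : QCat Q) where
  map : X.carrier → Y.carrier
  type_map : ∀ x, Y.type (map x) = X.type x
  hom_le : ∀ x x', X.hom x x' ≤
    eqToHom (type_map x).symm ≫ Y.hom (map x) (map x') ≫ eqToHom (type_map x')

section QCat

variable {Q : Type u} [Quantaloid Q]

/-- The category `Q`-**Cat** of `Q`-categories and `Q`-functors. -/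
instance : Category (QCat Q) where
  Hom X Y := QFunctor X Y
  id X := ⟨fun x => x, fun _ => rfl, fun x x' => by simp⟩
  comp {X Y Z} f g := ⟨fun x => g.map (f.map x), fun x => (g.type_map _).trans (f.type_map x),
    fun x x' => by
      refine (f.hom_le x x').trans ?_
      refine (comp_mono le_rfl (comp_mono (g.hom_le _ _) le_rfl)).trans ?_
      simp⟩

theorem QCat.hom_ext {X Y : QCat Q} {f g : X ⟶ Y} (h : ∀ x, f.map x = g.map x) : f = g :=
  QFunctor.ext (funext h)

@[simp] theorem QCat.id_map (X : QCat Q) (x : X.carrier) : QFunctor.map (𝟙 X) x = x := rfl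

@[simp] theorem QCat.comp_map {X Y Z : QCat Q} (f : X ⟶ Y) (g : Y ⟶ Z) (x : X.carrier) :
    QFunctor.map (f ≫ g) x = g.map (f.map x) := rfl

/-- The underlying preorder of a `Q`-category: `x ≤ y` iff `|x| = |y|` and `1 ≤ α(x,y)`. -/
def QCat.le (X : QCat Q) (x y : X.carrier) : Prop :=
  ∃ h : X.type x = X.type y, eqToHom h ≤ X.hom x y

/-- Separated `Q`-categories. -/
def QCat.IsSeparated (X : QCat Q) : Prop := ∀ x y, X.le x y → X.le y x → x = y

theorem QCat.le_refl (X : QCat Q) (x : X.carrier) : X.le x x := ⟨rfl, X.id_le x⟩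

theorem QCat.le_trans (X : QCat Q) {x y z : X.carrier} (h : X.le x y) (k : X.le y z) :
    X.le x z := by
  obtain ⟨h, h'⟩ := h
  obtain ⟨k, k'⟩ := k
  refine ⟨h.trans k, ?_⟩
  rw [← eqToHom_trans h k]
  exact (comp_mono h' k').trans (X.comp_le _ _ _)

theorem QFunctor.mono {X Y : QCat Q} (f : X ⟶ Y) {x y : X.carrier} (h : X.le x y) :
    Y.le (f.map x) (f.map y) := by
  obtain ⟨h, h'⟩ := h
  refine ⟨(f.type_map x).trans (h.trans (f.type_map y).symm), ?_⟩
  have := comp_mono (le_refl (eqToHom (f.type_map x)))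
    (comp_mono (h'.trans (f.hom_le x y)) (le_refl (eqToHom (f.type_map y).symm)))
  simpa using this

/-- `f ⊣ g` in `Q`-**Cat**: `1 ≤ gf` and `fg ≤ 1`, pointwise in the underlying orders. -/
def IsAdjoint {X Y : QCat Q} (f : X ⟶ Y) (g : Y ⟶ X) : Prop :=
  (∀ x, X.le x (g.map (f.map x))) ∧ ∀ y, Y.le (f.map (g.map y)) y

/-- `f` is a left adjoint `Q`-functor. -/
def IsLeftAdjoint {X Y : QCat Q} (f : X ⟶ Y) : Prop := ∃ g : Y ⟶ X, IsAdjoint f g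

theorem IsAdjoint.le_iff {X Y : QCat Q} {f : X ⟶ Y} {g : Y ⟶ X} (h : IsAdjoint f g)
    {x : X.carrier} {y : Y.carrier} : Y.le (f.map x) y ↔ X.le x (g.map y) :=
  ⟨fun k => X.le_trans (h.1 x) (g.mono k), fun k => Y.le_trans (f.mono k) (h.2 y)⟩

theorem IsAdjoint.id (X : QCat Q) : IsAdjoint (𝟙 X) (𝟙 X) :=
  ⟨fun x => X.le_refl x, fun x => X.le_refl x⟩

theorem IsAdjoint.comp {X Y Z : QCat Q} {f : X ⟶ Y} {g : Y ⟶ X} {f' : Y ⟶ Z} {g' : Z ⟶ Y}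
    (h : IsAdjoint f g) (h' : IsAdjoint f' g') : IsAdjoint (f ≫ f') (g' ≫ g) :=
  ⟨fun x => X.le_trans (h.1 x) (g.mono (h'.1 _)), fun z => Z.le_trans (f'.mono (h.2 _)) (h'.2 z)⟩

/-! ### Presheaves -/

/-- A presheaf of type `q` on `X`: a `Q`-distributor from `X` to the one-object `Q`-category of
type `q` with hom `1_q`. -/
@[ext]
structure Presheaf (X : QCat Q) (q : Q) where
  val : ∀ x : X.carrier, X.type x ⟶ q
  dist : ∀ x x', X.hom x' x ≫ val x ≤ val x'

/-- The `Q`-category `PX` of presheaves on `X`, with hom `μ' ↙ μ = ⋀ x, μ'(x) ↙ μ(x)`. -/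
abbrev presheafCat (X : QCat Q) : QCat Q where
  carrier := Σ q : Q, Presheaf X q
  type μ := μ.1
  hom μ μ' := ⨅ x, limp (μ'.2.val x) (μ.2.val x)
  id_le μ := le_iInf fun x => le_limp.2 (by simp)
  comp_le μ ν ξ := le_iInf fun x => le_limp.2 (by
    rw [← Category.assoc]
    refine (comp_mono (le_limp.1 (iInf_le _ x)) le_rfl).trans ?_
    exact le_limp.1 (iInf_le _ x))

theorem presheafCat_le_hom {X : QCat Q} {μ ν : (presheafCat X).carrier} {u : μ.1 ⟶ ν.1} :
    u ≤ (presheafCat X).hom μ ν ↔ ∀ x, μ.2.val x ≫ u ≤ ν.2.val x :=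
  le_iInf_iff.trans (forall_congr' fun _ => le_limp)

theorem presheafCat_comp_hom {X : QCat Q} (μ ν : (presheafCat X).carrier) (x : X.carrier) :
    μ.2.val x ≫ (presheafCat X).hom μ ν ≤ ν.2.val x :=
  presheafCat_le_hom.1 le_rfl x

theorem presheafCat_le {X : QCat Q} {μ ν : (presheafCat X).carrier} :
    (presheafCat X).le μ ν ↔ ∃ h : μ.1 = ν.1, ∀ x, μ.2.val x ≫ eqToHom h ≤ ν.2.val x :=
  exists_congr fun _ => presheafCat_le_hom

theorem presheafCat_isSeparated (X : QCat Q) : (presheafCat X).IsSeparated := by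
  rintro ⟨q, μ⟩ ⟨q', ν⟩ h k
  obtain ⟨h, h'⟩ := presheafCat_le.1 h
  obtain ⟨_, k'⟩ := presheafCat_le.1 k
  dsimp only at h
  subst h
  congr 1
  ext x
  exact le_antisymm (by simpa using h' x) (by simpa using k' x)

/-- The Yoneda embedding `y_X : X ⟶ PX`, `x ↦ α(-,x)`. -/
abbrev yoneda (X : QCat Q) : X ⟶ presheafCat X where
  map x := ⟨X.type x, ⟨fun z => X.hom z x, fun _ _ => X.comp_le _ _ _⟩⟩
  type_map _ := rfl
  hom_le x x' := by
    simp only [eqToHom_refl, Category.id_comp, Category.comp_id]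
    exact le_iInf fun z => le_limp.2 (X.comp_le _ _ _)

/-- `X` is complete: the Yoneda embedding has a left adjoint in `Q`-**Cat**. -/
def QCat.IsComplete (X : QCat Q) : Prop := ∃ s : presheafCat X ⟶ X, IsAdjoint s (yoneda X)

/-- The direct image `f^→ : PX ⟶ PY`, `f^→ μ = μ ∘ f^♮`, that is
`(f^→ μ)(y) = ⋁ x, μ(x) ∘ β(y, fx)`. -/
abbrev directImage {X Y : QCat Q} (f : X ⟶ Y) : presheafCat X ⟶ presheafCat Y where
  map μ := ⟨μ.1, ⟨fun y => ⨆ x, Y.hom y (f.map x) ≫ eqToHom (f.type_map x) ≫ μ.2.val x,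
    fun y y' => by
      rw [comp_iSup]
      refine iSup_mono fun x => ?_
      rw [← Category.assoc]
      exact comp_mono (Y.comp_le _ _ _) le_rfl⟩⟩
  type_map _ := rfl
  hom_le μ ν := by
    simp only [eqToHom_refl, Category.id_comp, Category.comp_id]
    refine le_iInf fun y => le_limp.2 ?_
    rw [iSup_comp]
    refine iSup_mono fun x => ?_
    rw [Category.assoc, Category.assoc]
    exact comp_mono le_rfl (comp_mono le_rfl (presheafCat_comp_hom μ ν x))

/-- The inverse image `f^← : PY ⟶ PX`, `f^← λ = λ ∘ f_♮`, that is `(f^← λ)(x) = λ(fx)`. -/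
abbrev inverseImage {X Y : QCat Q} (f : X ⟶ Y) : presheafCat Y ⟶ presheafCat X where
  map μ := ⟨μ.1, ⟨fun x => eqToHom (f.type_map x).symm ≫ μ.2.val (f.map x),
    fun x x' => by
      refine (comp_mono (f.hom_le x' x) le_rfl).trans ?_
      simp only [Category.assoc, eqToHom_trans_assoc, eqToHom_refl, Category.id_comp]
      exact comp_mono le_rfl (μ.2.dist _ _)⟩⟩
  type_map _ := rfl
  hom_le μ ν := by
    simp only [eqToHom_refl, Category.id_comp, Category.comp_id]
    refine le_iInf fun x => le_limp.2 ?_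
    rw [Category.assoc]
    exact comp_mono le_rfl (presheafCat_comp_hom μ ν _)

theorem directImage_isAdjoint {X Y : QCat Q} (f : X ⟶ Y) :
    IsAdjoint (directImage f) (inverseImage f) := by
  constructor
  · intro μ
    refine presheafCat_le.2 ⟨rfl, fun x => ?_⟩
    have h1 : μ.2.val x ≤ eqToHom (f.type_map x).symm ≫
        Y.hom (f.map x) (f.map x) ≫ eqToHom (f.type_map x) ≫ μ.2.val x := by
      have := comp_mono (le_refl (eqToHom (f.type_map x).symm))
        (comp_mono (Y.id_le (f.map x)) (le_refl (eqToHom (f.type_map x) ≫ μ.2.val x)))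
      simpa using this
    have h2 : eqToHom (f.type_map x).symm ≫
        Y.hom (f.map x) (f.map x) ≫ eqToHom (f.type_map x) ≫ μ.2.val x ≤
        ((inverseImage f).map ((directImage f).map μ)).2.val x :=
      comp_mono le_rfl (le_iSup (fun x' => Y.hom (f.map x) (f.map x') ≫
        eqToHom (f.type_map x') ≫ μ.2.val x') x)
    exact (by simp : μ.2.val x ≫ eqToHom _ = μ.2.val x).le.trans (h1.trans h2)
  · intro ν
    refine presheafCat_le.2 ⟨rfl, fun y => ?_⟩
    refine (by simp : _ ≫ eqToHom _ = ((directImage f).map ((inverseImage f).map ν)).2.val y).le.trans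
      (iSup_le fun x => ?_)
    refine le_trans (le_of_eq ?_) (ν.2.dist (f.map x) y)
    simp [inverseImage]

theorem directImage_id (X : QCat Q) : directImage (𝟙 X) = 𝟙 (presheafCat X) := by
  refine QCat.hom_ext fun μ => presheafCat_isSeparated X _ _ ?_ ?_
  · refine (directImage_isAdjoint _).le_iff.2 (presheafCat_le.2 ⟨rfl, fun x => ?_⟩)
    simp [inverseImage]
  · have := (directImage_isAdjoint (𝟙 X)).1 μ
    refine (presheafCat X).le_trans this (presheafCat_le.2 ⟨rfl, fun x => ?_⟩)
    simp [inverseImage]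

theorem directImage_comp {X Y Z : QCat Q} (f : X ⟶ Y) (g : Y ⟶ Z) :
    directImage (f ≫ g) = directImage f ≫ directImage g := by
  have key : ∀ (μ : (presheafCat X).carrier) (ν : (presheafCat Z).carrier),
      (presheafCat Z).le ((directImage (f ≫ g)).map μ) ν ↔
        (presheafCat Z).le ((directImage f ≫ directImage g).map μ) ν := by
    intro μ ν
    rw [(directImage_isAdjoint _).le_iff,
      ((directImage_isAdjoint f).comp (directImage_isAdjoint g)).le_iff, presheafCat_le,
      presheafCat_le]
    refine exists_congr fun h => forall_congr' fun x => ?_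
    simp [inverseImage]
  exact QCat.hom_ext fun μ => presheafCat_isSeparated Z _ _
    ((key _ _).2 ((presheafCat Z).le_refl _)) ((key _ _).1 ((presheafCat Z).le_refl _))

/-- The supremum in `PX`: `sup Φ = ⋁ μ, Φ(μ) ∘ μ`. -/
abbrev presheafSup (X : QCat Q) : presheafCat (presheafCat X) ⟶ presheafCat X where
  map Φ := ⟨Φ.1, ⟨fun x => ⨆ μ : (presheafCat X).carrier, μ.2.val x ≫ Φ.2.val μ,
    fun x x' => by
      rw [comp_iSup]
      refine iSup_mono fun μ => ?_
      rw [← Category.assoc]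
      exact comp_mono (μ.2.dist _ _) le_rfl⟩⟩
  type_map _ := rfl
  hom_le Φ Ψ := by
    simp only [eqToHom_refl, Category.id_comp, Category.comp_id]
    refine le_iInf fun x => le_limp.2 ?_
    rw [iSup_comp]
    refine iSup_mono fun μ => ?_
    rw [Category.assoc]
    exact comp_mono le_rfl (presheafCat_comp_hom Φ Ψ μ)

theorem presheafSup_isAdjoint (X : QCat Q) :
    IsAdjoint (presheafSup X) (yoneda (presheafCat X)) := by
  constructor
  · intro Φ
    refine presheafCat_le.2 ⟨rfl, fun μ => ?_⟩
    refine (by simp : Φ.2.val μ ≫ eqToHom _ = Φ.2.val μ).le.trans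
      (le_iInf fun x => le_limp.2 ?_)
    exact le_iSup (fun μ : (presheafCat X).carrier => μ.2.val x ≫ Φ.2.val μ) μ
  · intro μ
    refine presheafCat_le.2 ⟨rfl, fun x => ?_⟩
    refine (by simp : _ ≫ eqToHom _ =
      ((presheafSup X).map ((yoneda (presheafCat X)).map μ)).2.val x).le.trans
      (iSup_le fun ν => presheafCat_comp_hom ν μ x)

theorem presheafCat_isComplete (X : QCat Q) : (presheafCat X).IsComplete :=
  ⟨presheafSup X, presheafSup_isAdjoint X⟩

end QCat

/-! ### Separated complete `Q`-categories -/

/-- Separated complete `Q`-categories. -/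
structure QSup (Q : Type u) [Quantaloid Q] where
  toQCat : QCat Q
  separated : toQCat.IsSeparated
  complete : toQCat.IsComplete

/-- Left adjoint `Q`-functors. -/
@[ext]
structure QSup.Hom {Q : Type u} [Quantaloid Q] (X Y : QSup Q) where
  toQFunctor : X.toQCat ⟶ Y.toQCat
  isLeftAdjoint : IsLeftAdjoint toQFunctor

section QSup

variable {Q : Type u} [Quantaloid Q]

/-- The category `Q`-**Sup** of separated complete `Q`-categories and left adjoint
`Q`-functors. -/
instance : Category (QSup Q) where
  Hom X Y := QSup.Hom X Y
  id X := ⟨𝟙 _, 𝟙 _, IsAdjoint.id _⟩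
  comp f g := ⟨f.toQFunctor ≫ g.toQFunctor, by
    obtain ⟨f', hf⟩ := f.isLeftAdjoint
    obtain ⟨g', hg⟩ := g.isLeftAdjoint
    exact ⟨_, hf.comp hg⟩⟩

theorem QSup.hom_ext {X Y : QSup Q} {f g : X ⟶ Y}
    (h : ∀ x, f.toQFunctor.map x = g.toQFunctor.map x) : f = g :=
  QSup.Hom.ext (QCat.hom_ext h)

/-- The left adjoint `sup_X : PX ⟶ X` of the Yoneda embedding (unique since `X` is
separated). -/
noncomputable def QSup.sup (X : QSup Q) : presheafCat X.toQCat ⟶ X.toQCat :=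
  X.complete.choose

theorem QSup.sup_isAdjoint (X : QSup Q) : IsAdjoint X.sup (yoneda X.toQCat) :=
  X.complete.choose_spec

variable (Q)

/-- The forgetful functor `U_c : Q-Sup ⥤ Q-Cat`. -/
abbrev Uc : QSup Q ⥤ QCat Q where
  obj X := X.toQCat
  map f := f.toQFunctor

/-- The presheaf functor `P_c : Q-Cat ⥤ Q-Sup`, `X ↦ PX`, `f ↦ f^→`. -/
abbrev Pc : QCat Q ⥤ QSup Q where
  obj X := ⟨presheafCat X, presheafCat_isSeparated X, presheafCat_isComplete X⟩
  map f := ⟨directImage f, _, directImage_isAdjoint f⟩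
  map_id X := QSup.Hom.ext (directImage_id X)
  map_comp f g := QSup.Hom.ext (directImage_comp f g)

variable {Q}

theorem directImage_yoneda {X Y : QCat Q} (f : X ⟶ Y) (x : X.carrier) :
    (directImage f).map ((yoneda X).map x) = (yoneda Y).map (f.map x) := by
  refine presheafCat_isSeparated Y _ _ ?_ ?_
  · refine (directImage_isAdjoint f).le_iff.2 (presheafCat_le.2 ⟨(f.type_map x).symm, fun z => ?_⟩)
    have := comp_mono (f.hom_le z x) (le_refl (eqToHom (f.type_map x).symm))
    simpa [inverseImage, yoneda] using this
  · refine presheafCat_le.2 ⟨f.type_map x, fun y => ?_⟩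
    refine le_trans ?_ (le_iSup (fun x' => Y.hom y (f.map x') ≫
        eqToHom (f.type_map x') ≫ X.hom x' x) x)
    have := comp_mono (le_refl (Y.hom y (f.map x)))
      (comp_mono (le_refl (eqToHom (f.type_map x))) (X.id_le x))
    simpa [yoneda] using this

theorem sup_directImage {X Y : QSup Q} (f : X ⟶ Y) (μ : (presheafCat X.toQCat).carrier) :
    Y.sup.map ((directImage f.toQFunctor).map μ) = f.toQFunctor.map (X.sup.map μ) := by
  obtain ⟨g, hg⟩ := f.isLeftAdjoint
  have key : ∀ y, Y.toQCat.le (Y.sup.map ((directImage f.toQFunctor).map μ)) y ↔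
      Y.toQCat.le (f.toQFunctor.map (X.sup.map μ)) y := by
    intro y
    rw [Y.sup_isAdjoint.le_iff, (directImage_isAdjoint _).le_iff, hg.le_iff,
      X.sup_isAdjoint.le_iff]
    have h1 : (presheafCat X.toQCat).le
        ((inverseImage f.toQFunctor).map ((yoneda Y.toQCat).map y))
        ((yoneda X.toQCat).map (g.map y)) := by
      refine presheafCat_le.2 ⟨(g.type_map y).symm, fun x => ?_⟩
      obtain ⟨e, he⟩ := hg.1 x
      have k1 := g.hom_le (f.toQFunctor.map x) y
      have k2 := comp_mono he (le_refl (X.toQCat.hom (g.map (f.toQFunctor.map x)) (g.map y)))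
      have k3 := k2.trans (X.toQCat.comp_le _ _ _)
      refine le_trans ?_ k3
      have := comp_mono (le_refl (eqToHom (f.toQFunctor.type_map x).symm))
        (comp_mono k1 (le_refl (eqToHom (g.type_map y).symm)))
      simpa [inverseImage, yoneda] using this
    have h2 : (presheafCat X.toQCat).le ((yoneda X.toQCat).map (g.map y))
        ((inverseImage f.toQFunctor).map ((yoneda Y.toQCat).map y)) := by
      refine (directImage_isAdjoint _).le_iff.1 ?_
      rw [directImage_yoneda]
      exact (yoneda Y.toQCat).mono (hg.2 y)
    exact ⟨fun h => (presheafCat _).le_trans h h1, fun h => (presheafCat _).le_trans h h2⟩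
  exact Y.separated _ _ ((key _).2 (Y.toQCat.le_refl _)) ((key _).1 (Y.toQCat.le_refl _))

variable (Q)

/-- The adjunction `P_c ⊣ U_c` with unit `y` and counit `sup`. -/
noncomputable def pcAdj : Pc Q ⊣ Uc Q where
  unit :=
    { app := fun X => yoneda X
      naturality := fun X Y f => QCat.hom_ext fun x => (directImage_yoneda f x).symm }
  counit :=
    { app := fun X => ⟨X.sup, _, X.sup_isAdjoint⟩
      naturality := fun X Y f => QSup.hom_ext fun μ => sup_directImage f μ }
  left_triangle_components X := QSup.hom_ext fun μ => by
    have h : ∀ ν, (presheafCat X).le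
        (((Pc Q).obj X).sup.map ((directImage (yoneda X)).map μ)) ν ↔ (presheafCat X).le μ ν := by
      intro ν
      rw [((Pc Q).obj X).sup_isAdjoint.le_iff, (directImage_isAdjoint _).le_iff]
      have e : (inverseImage (yoneda X)).map ((yoneda (presheafCat X)).map ν) = ν := by
        obtain ⟨q, ν⟩ := ν
        have : ∀ x, (presheafCat X).hom ((yoneda X).map x) ⟨q, ν⟩ = ν.val x := fun x =>
          le_antisymm
            (by
              have := presheafCat_comp_hom ((yoneda X).map x) ⟨q, ν⟩ x
              refine le_trans ?_ this
              have h := comp_mono (X.id_le x)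
                (le_refl ((presheafCat X).hom ((yoneda X).map x) ⟨q, ν⟩))
              rwa [Category.id_comp] at h)
            (le_iInf fun z => le_limp.2 (ν.dist _ _))
        refine congrArg (Sigma.mk q) (Presheaf.ext (funext fun x => ?_))
        refine Eq.trans ?_ (this x)
        simp
      exact iff_of_eq (congrArg _ e)
    exact presheafCat_isSeparated X _ _ ((h _).2 ((presheafCat X).le_refl _))
      ((h _).1 ((presheafCat X).le_refl _))
  right_triangle_components X := QCat.hom_ext fun x => by
    refine X.separated _ _ (X.sup_isAdjoint.2 x) ?_
    obtain ⟨e, he⟩ := presheafCat_le.1 (X.sup_isAdjoint.1 ((yoneda X.toQCat).map x))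
    refine ⟨e, le_trans ?_ (he x)⟩
    have h := comp_mono (X.toQCat.id_le x) (le_refl (eqToHom e))
    rwa [Category.id_comp] at h

end QSup

/-! ### Symmetric `Q`-categories -/

section SymCat

variable {Q : Type u} [InvolutiveQuantaloid Q]

open InvolutiveQuantaloid (dag)

theorem dag_mono {p q : Q} {u v : p ⟶ q} (h : u ≤ v) : dag u ≤ dag v := by
  have : v = sSup {u, v} := by rw [sSup_pair, sup_eq_right.2 h]
  rw [this, InvolutiveQuantaloid.dag_sSup]
  exact le_iSup₂_of_le u (by simp) le_rfl

theorem dag_le_iff {p q : Q} {u : p ⟶ q} {v : q ⟶ p} : dag u ≤ v ↔ u ≤ dag v :=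
  ⟨fun h => by simpa [InvolutiveQuantaloid.dag_dag] using dag_mono h,
    fun h => by simpa [InvolutiveQuantaloid.dag_dag] using dag_mono h⟩

theorem dag_inf {p q : Q} (u v : p ⟶ q) : dag (u ⊓ v) = dag u ⊓ dag v := by
  refine le_antisymm (le_inf (dag_mono inf_le_left) (dag_mono inf_le_right)) ?_
  rw [← dag_le_iff]
  exact le_inf (dag_le_iff.2 inf_le_left) (dag_le_iff.2 inf_le_right)

theorem dag_eqToHom {p q : Q} (h : p = q) : dag (eqToHom h) = eqToHom h.symm := by
  subst h
  exact InvolutiveQuantaloid.dag_id _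

variable (Q) in
/-- Symmetric `Q`-categories: `α(x,y) = α(y,x)°`. -/
def isSymmetric : ObjectProperty (QCat Q) := fun X => ∀ x y, X.hom x y = dag (X.hom y x)

variable (Q) in
/-- The full subcategory `Q`-**SymCat** of `Q`-**Cat** of symmetric `Q`-categories. -/
abbrev SymCat : Type (u + 1) := (isSymmetric Q).FullSubcategory

/-- The symmetrization `X_s` of `X`, with hom `α_s(x,y) = α(x,y) ∧ α(y,x)°`. -/
abbrev symmetrize (X : QCat Q) : SymCat Q where
  obj :=
    { carrier := X.carrier
      type := X.type
      hom := fun x y => X.hom x y ⊓ dag (X.hom y x)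
      id_le := fun x => le_inf (X.id_le x) (by
        rw [← dag_le_iff, InvolutiveQuantaloid.dag_id]; exact X.id_le x)
      comp_le := fun x y z => le_inf
        ((comp_mono inf_le_left inf_le_left).trans (X.comp_le x y z))
        (by
          refine (comp_mono inf_le_right inf_le_right).trans ?_
          rw [← InvolutiveQuantaloid.dag_comp]
          exact dag_mono (X.comp_le z y x)) }
  property x y := by
    change X.hom x y ⊓ dag (X.hom y x) = dag (X.hom y x ⊓ dag (X.hom x y))
    rw [dag_inf, InvolutiveQuantaloid.dag_dag, inf_comm]

/-- A `Q`-functor from a symmetric `Q`-category to `Y` is one to `Y_s`. -/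
abbrev toSymmetrize {X : QCat Q} (hX : isSymmetric Q X) {Y : QCat Q} (f : X ⟶ Y) :
    X ⟶ (symmetrize Y).obj where
  map := f.map
  type_map := f.type_map
  hom_le x x' := by
    have h : ∀ x x', eqToHom (f.type_map x) ≫ X.hom x x' ≫ eqToHom (f.type_map x').symm ≤
        Y.hom (f.map x) (f.map x') := by
      intro x x'
      have := comp_mono (le_refl (eqToHom (f.type_map x)))
        (comp_mono (f.hom_le x x') (le_refl (eqToHom (f.type_map x').symm)))
      simpa using this
    have h2 : eqToHom (f.type_map x) ≫ X.hom x x' ≫ eqToHom (f.type_map x').symm ≤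
        dag (Y.hom (f.map x') (f.map x)) := by
      rw [← dag_le_iff]
      refine le_trans (le_of_eq ?_) (h x' x)
      rw [InvolutiveQuantaloid.dag_comp, InvolutiveQuantaloid.dag_comp, dag_eqToHom, dag_eqToHom,
        ← hX, Category.assoc]
    have := comp_mono (le_refl (eqToHom (f.type_map x).symm))
      (comp_mono (le_inf (h x x') h2) (le_refl (eqToHom (f.type_map x'))))
    simpa using this

/-- The identity map `X_s ⟶ X`. -/
abbrev fromSymmetrize (X : QCat Q) : (symmetrize X).obj ⟶ X where
  map x := x
  type_map _ := rfl
  hom_le x x' := by simp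

variable (Q)

/-- The symmetrization functor `(-)_s : Q-Cat ⥤ Q-SymCat`; it does not change underlying maps. -/
abbrev symmetrization : QCat Q ⥤ SymCat Q where
  obj X := symmetrize X
  map {X Y} f := ObjectProperty.homMk
    (toSymmetrize (symmetrize X).property (fromSymmetrize X ≫ f))

/-- The inclusion of symmetric `Q`-categories is left adjoint to symmetrization. -/
def symAdj : (isSymmetric Q).ι ⊣ symmetrization Q where
  unit := { app := fun X => ObjectProperty.homMk (toSymmetrize X.property (𝟙 X.obj)) }
  counit := { app := fun X => fromSymmetrize X }

/-- The functor `U_s : Q-Sup ⥤ Q-SymCat`. -/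
abbrev Us : QSup Q ⥤ SymCat Q := Uc Q ⋙ symmetrization Q

/-- The functor `P_s : Q-SymCat ⥤ Q-Sup`. -/
abbrev Ps : SymCat Q ⥤ QSup Q := (isSymmetric Q).ι ⋙ Pc Q

/-- The adjunction `P_s ⊣ U_s`. -/
noncomputable def psAdj : Ps Q ⊣ Us Q := (symAdj Q).comp (pcAdj Q)

/-- The monad on `Q`-**SymCat** induced by `P_s ⊣ U_s`. -/
noncomputable abbrev psMonad : Monad (SymCat Q) := (psAdj Q).toMonad

end SymCat

/-! ### Strict monadicity -/

/-- A right adjoint functor is strictly monadic if the comparison functor to the Eilenberg–Moore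
category of the induced monad is an isomorphism of categories. (Left adjoints being unique up to
isomorphism, it does not matter which adjunction is used; all of them are demanded here.) -/
def IsStrictlyMonadic {C D : Type*} [Category* C] [Category* D] (G : D ⥤ C) : Prop :=
  G.IsRightAdjoint ∧ ∀ (L : C ⥤ D) (adj : L ⊣ G), (Monad.comparison adj).IsIso

/-! ### The quantaloid `D_*(V)` of an involutive quantale `V` -/

open scoped Quantale

/-- An involutive (unital) quantale: the involution `star` preserves arbitrary joins. -/
class IsInvolutiveQuantale (V : Type u) [Monoid V] [CompleteLattice V] [StarMul V] : Prop
    extends IsQuantale V where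
  star_sSup : ∀ S : Set V, star (sSup S) = ⨆ a ∈ S, star a

/-- Objects of `D_*(V)`: hermitian elements of `V`. -/
structure DStar (V : Type u) [Star V] where
  val : V
  herm : star val = val

/-- Arrows `p ⟶ q` of `D_*(V)`: elements `d ≤ p ∧ q` with `(d / p) & p = d = q & (q \ d)`.
Here `p ⇨ₗ d` is `d / p` and `q ⇨ᵣ d` is `q \ d`. -/
@[ext]
structure DStar.Hom {V : Type u} [Monoid V] [CompleteLattice V] [StarMul V]
    (p q : DStar V) where
  val : V
  le_inf : val ≤ p.val ⊓ q.val
  left_div : (p.val ⇨ₗ val) * p.val = val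
  right_div : q.val * (q.val ⇨ᵣ val) = val

namespace DStar

variable {V : Type u} [Monoid V] [CompleteLattice V] [StarMul V]

theorem comp_eq {p q r : DStar V} (d : Hom p q) (e : Hom q r) :
    (q.val ⇨ₗ e.val) * d.val = e.val * (q.val ⇨ᵣ d.val) := by
  conv_lhs => rw [← d.right_div]
  conv_rhs => rw [← e.left_div]
  rw [mul_assoc]

variable [IsInvolutiveQuantale V]

theorem ldiv_mul_le (a b : V) : (a ⇨ₗ b) * a ≤ b :=
  Quantale.leftMulResiduation_le_iff_mul_le.1 le_rfl

theorem mul_rdiv_le (a b : V) : a * (a ⇨ᵣ b) ≤ b :=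
  Quantale.rightMulResiduation_le_iff_mul_le.1 le_rfl

theorem star_mono {a b : V} (h : a ≤ b) : star a ≤ star b := by
  have : b = sSup {a, b} := by rw [sSup_pair, sup_eq_right.2 h]
  rw [this, IsInvolutiveQuantale.star_sSup]
  exact le_iSup₂_of_le a (by simp) le_rfl

instance (p q : DStar V) : PartialOrder (Hom p q) :=
  PartialOrder.lift Hom.val fun _ _ => Hom.ext

instance (p q : DStar V) : SupSet (Hom p q) where
  sSup S :=
    { val := ⨆ d ∈ S, d.val
      le_inf := iSup₂_le fun d _ => d.le_inf
      left_div := le_antisymm (ldiv_mul_le _ _) (iSup₂_le fun d hd => by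
        conv_lhs => rw [← d.left_div]
        refine mul_le_mul_left ?_ _
        exact Quantale.leftMulResiduation_le_iff_mul_le.2
          ((ldiv_mul_le _ _).trans (le_iSup₂_of_le d hd le_rfl)))
      right_div := le_antisymm (mul_rdiv_le _ _) (iSup₂_le fun d hd => by
        conv_lhs => rw [← d.right_div]
        refine mul_le_mul_right ?_ _
        exact Quantale.rightMulResiduation_le_iff_mul_le.2
          ((mul_rdiv_le _ _).trans (le_iSup₂_of_le d hd le_rfl))) }

/-- The order on arrows is inherited from `V`, and joins are those of `V`. -/
instance (p q : DStar V) : CompleteLattice (Hom p q) :=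
  completeLatticeOfSup _ fun S =>
    ⟨fun d hd => le_iSup₂_of_le (f := fun (d : Hom p q) (_ : d ∈ S) => d.val) d hd le_rfl,
      fun _ he => iSup₂_le fun _ hd => he hd⟩

theorem val_sSup {p q : DStar V} (S : Set (Hom p q)) : (sSup S).val = ⨆ d ∈ S, d.val := rfl

theorem val_iSup {p q : DStar V} {ι : Sort*} (f : ι → Hom p q) :
    (⨆ i, f i).val = ⨆ i, (f i).val := by
  rw [iSup, val_sSup, iSup_range]

/-- Identities of `D_*(V)`. -/
def idHom (p : DStar V) : Hom p p where
  val := p.val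
  le_inf := le_inf le_rfl le_rfl
  left_div := le_antisymm (ldiv_mul_le _ _) (by
    conv_lhs => rw [← one_mul p.val]
    exact mul_le_mul_left
      (Quantale.leftMulResiduation_le_iff_mul_le.2 (one_mul p.val).le) _)
  right_div := le_antisymm (mul_rdiv_le _ _) (by
    conv_lhs => rw [← mul_one p.val]
    exact mul_le_mul_right
      (Quantale.rightMulResiduation_le_iff_mul_le.2 (mul_one p.val).le) _)

/-- Composition in `D_*(V)`: `e ∘ d = (e / q) & d = e & (q \ d)`. -/
def compHom {p q r : DStar V} (d : Hom p q) (e : Hom q r) : Hom p r where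
  val := (q.val ⇨ₗ e.val) * d.val
  le_inf := by
    refine le_inf ?_ ?_
    · refine le_trans ?_ (d.le_inf.trans inf_le_left)
      have h : (q.val ⇨ₗ e.val) ≤ (q.val ⇨ₗ q.val) :=
        Quantale.leftMulResiduation_le_iff_mul_le.2
          ((ldiv_mul_le _ _).trans (e.le_inf.trans inf_le_left))
      refine (mul_le_mul_left h _).trans ?_
      conv_lhs => rw [← d.right_div]
      conv_rhs => rw [← d.right_div]
      rw [← mul_assoc]
      exact mul_le_mul_left (ldiv_mul_le _ _) _
    · rw [comp_eq]
      refine le_trans ?_ (e.le_inf.trans inf_le_right)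
      have h : (q.val ⇨ᵣ d.val) ≤ (q.val ⇨ᵣ q.val) :=
        Quantale.rightMulResiduation_le_iff_mul_le.2
          ((mul_rdiv_le _ _).trans (d.le_inf.trans inf_le_right))
      refine (mul_le_mul_right h _).trans ?_
      conv_lhs => rw [← e.left_div]
      conv_rhs => rw [← e.left_div]
      rw [mul_assoc]
      exact mul_le_mul_right (mul_rdiv_le _ _) _
  left_div := le_antisymm (ldiv_mul_le _ _) (by
    conv_lhs => rw [← d.left_div, ← mul_assoc]
    refine mul_le_mul_left (Quantale.leftMulResiduation_le_iff_mul_le.2 ?_) _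
    rw [mul_assoc, d.left_div])
  right_div := le_antisymm (mul_rdiv_le _ _) (by
    rw [comp_eq]
    conv_lhs => rw [← e.right_div, mul_assoc]
    refine mul_le_mul_right (Quantale.rightMulResiduation_le_iff_mul_le.2 ?_) _
    rw [← mul_assoc, e.right_div])

theorem star_ldiv (a b : V) : star (a ⇨ₗ b) = (star a ⇨ᵣ star b) := by
  apply le_antisymm
  · refine Quantale.rightMulResiduation_le_iff_mul_le.2 ?_
    rw [← star_mul]
    exact star_mono (ldiv_mul_le _ _)
  · rw [← star_star (star a ⇨ᵣ star b)]
    refine star_mono (Quantale.leftMulResiduation_le_iff_mul_le.2 ?_)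
    have := star_mono (mul_rdiv_le (star a) (star b))
    rwa [star_mul, star_star, star_star] at this

theorem star_rdiv (a b : V) : star (a ⇨ᵣ b) = (star a ⇨ₗ star b) := by
  have := star_ldiv (star a) (star b)
  rw [star_star, star_star] at this
  rw [← this, star_star]

/-- The involution of `D_*(V)`, lifted from `V`. -/
def dagHom {p q : DStar V} (d : Hom p q) : Hom q p where
  val := star d.val
  le_inf := by
    refine le_inf ?_ ?_
    · conv_rhs => rw [← q.herm]
      exact star_mono (d.le_inf.trans inf_le_right)
    · conv_rhs => rw [← p.herm]
      exact star_mono (d.le_inf.trans inf_le_left)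
  left_div := by
    conv_rhs => rw [← d.right_div]
    rw [star_mul, star_rdiv, q.herm]
  right_div := by
    conv_rhs => rw [← d.left_div]
    rw [star_mul, star_ldiv, p.herm]

theorem compHom_assoc {p q r s : DStar V} (d : Hom p q) (e : Hom q r) (f : Hom r s) :
    compHom (compHom d e) f = compHom d (compHom e f) := Hom.ext (by
  rw [show (compHom d (compHom e f)).val = (compHom e f).val * (q.val ⇨ᵣ d.val) from
    comp_eq d (compHom e f)]
  change (r.val ⇨ₗ f.val) * ((q.val ⇨ₗ e.val) * d.val) =
    (r.val ⇨ₗ f.val) * e.val * (q.val ⇨ᵣ d.val)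
  rw [comp_eq d e, mul_assoc])

theorem sSup_compHom {p q r : DStar V} (S : Set (Hom p q)) (e : Hom q r) :
    compHom (sSup S) e = ⨆ d ∈ S, compHom d e := Hom.ext (by
  simp only [val_iSup]
  change (q.val ⇨ₗ e.val) * (⨆ d ∈ S, d.val) = ⨆ d ∈ S, (q.val ⇨ₗ e.val) * d.val
  rw [← sSup_image, mul_sSup_distrib, iSup_image])

theorem compHom_sSup {p q r : DStar V} (d : Hom p q) (S : Set (Hom q r)) :
    compHom d (sSup S) = ⨆ e ∈ S, compHom d e := Hom.ext (by
  simp only [val_iSup]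
  have h : ∀ e : Hom q r, (compHom d e).val = e.val * (q.val ⇨ᵣ d.val) := comp_eq d
  simp only [h, val_sSup]
  rw [← sSup_image, sSup_mul_distrib, iSup_image])

theorem dagHom_comp {p q r : DStar V} (d : Hom p q) (e : Hom q r) :
    dagHom (compHom d e) = compHom (dagHom e) (dagHom d) := Hom.ext (by
  refine Eq.trans ?_ (comp_eq (dagHom e) (dagHom d)).symm
  change star ((q.val ⇨ₗ e.val) * d.val) = star d.val * (q.val ⇨ᵣ star e.val)
  rw [star_mul, star_ldiv, q.herm])

theorem dagHom_sSup {p q : DStar V} (S : Set (Hom p q)) :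
    dagHom (sSup S) = ⨆ d ∈ S, dagHom d := Hom.ext (by
  simp only [val_iSup]
  change star (⨆ d ∈ S, d.val) = ⨆ d ∈ S, star d.val
  rw [← sSup_image, IsInvolutiveQuantale.star_sSup, iSup_image])

/-- The involutive quantaloid `D_*(V)`. -/
instance : InvolutiveQuantaloid (DStar V) where
  Hom := Hom
  id := idHom
  comp := compHom
  id_comp d := Hom.ext d.left_div
  comp_id {_ q} d := Hom.ext ((comp_eq d (idHom q)).trans d.right_div)
  assoc := compHom_assoc
  homLattice p q := inferInstanceAs (CompleteLattice (Hom p q))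
  sSup_comp := sSup_compHom
  comp_sSup := compHom_sSup
  dag := dagHom
  dag_id p := Hom.ext p.herm
  dag_comp := dagHom_comp
  dag_dag _ := Hom.ext (star_star _)
  dag_sSup := dagHom_sSup

end DStar

/-- The category of `V`-sets: symmetric `D_*(V)`-categories. -/
abbrev QSet (V : Type u) [Monoid V] [CompleteLattice V] [StarMul V] [IsInvolutiveQuantale V] :
    Type (u + 1) :=
  SymCat (DStar V)

/-- The `V`-valued similarity `α(x,y)` of a `V`-set. -/
abbrev QSet.sim {V : Type u} [Monoid V] [CompleteLattice V] [StarMul V] [IsInvolutiveQuantale V]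
    (X : QSet V) (x y : X.obj.carrier) : V :=
  DStar.Hom.val (X.obj.hom x y)

/-- The `V`-powerset monad on `V`-sets. -/
noncomputable abbrev powersetMonad (V : Type u) [Monoid V] [CompleteLattice V] [StarMul V]
    [IsInvolutiveQuantale V] : Monad (QSet V) :=
  psMonad (DStar V)

/-- `(m, q)` is a potential `V`-subset of the `V`-set `X`; here `q` is hermitian. -/
structure IsPotentialSubset {V : Type u} [Monoid V] [CompleteLattice V] [StarMul V]
    [IsInvolutiveQuantale V] (X : QSet V) (m : X.obj.carrier → V) (q : V) : Prop where
  herm : star q = q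
  le_inf : ∀ x, m x ≤ X.sim x x ⊓ q
  left_div : ∀ x, (X.sim x x ⇨ₗ m x) * X.sim x x = m x
  right_div : ∀ x, q * (q ⇨ᵣ m x) = m x
  dist_eq : ∀ x y, (X.sim y y ⇨ₗ m y) * X.sim x y = m y * (X.sim y y ⇨ᵣ X.sim x y)
  dist_le : ∀ x y, (X.sim y y ⇨ₗ m y) * X.sim x y ≤ m x

end QEnriched

open QEnriched
open scoped Quantale

/-
By Beck's precise monadicity theorem it suffices that `U_s` creates coequalizers of `U_s`-split
pairs strictly. Let `q : Y_s ⟶ Z` be a split coequalizer of `f_s` and `g_s`, where `f ⊣ f'` and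
`g ⊣ g'` are left adjoints `X ⟶ Y`. The splittings are only functors between symmetrizations, but
the `Q`-functor `y ↦ g f' f g' y` sends `y` to the largest element of the fibre of `q` through `y`.
These elements form a reflective, hence complete, part of `Y`. Its symmetrization is `Z`, since
both `q` and its right inverse given by the largest elements do not decrease homs.
-/

namespace QEnriched

section Beck

open Limits

variable {C D : Type*} [Category* C] [Category* D] {L : C ⥤ D} {G : D ⥤ C}

/-- `h : Y ⟶ B` is a strict lift of `q : GY ⟶ Z` along `G`: `GB = Z` and `Gh = q`. The equality of
objects is transported along `eqToHom`. -/
def IsLift (G : D ⥤ C) {Y B : D} {Z : C} (q : G.obj Y ⟶ Z) (h : Y ⟶ B) : Prop :=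
  ∃ e : G.obj B = Z, G.map h ≫ eqToHom e = q

/-- Strict creation of coequalizers of `G`-split pairs, as in the precise monadicity theorem of
Beck: a split coequalizer `q` of `Gf` and `Gg` has a lift `h`, the codomain of a lift is unique on
the nose, and every lift is a coequalizer of `f` and `g`. -/
def CreatesSplitCoequalizers (G : D ⥤ C) : Prop :=
  ∀ ⦃X Y : D⦄ ⦃f g : X ⟶ Y⦄ ⦃Z : C⦄ ⦃q : G.obj Y ⟶ Z⦄, IsSplitCoequalizer (G.map f) (G.map g) q →
    (∃! B : D, ∃ h : Y ⟶ B, IsLift G q h) ∧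
      ∀ ⦃B : D⦄ (h : Y ⟶ B), IsLift G q h →
        ∃ w : f ≫ h = g ≫ h, Nonempty (IsColimit (Cofork.ofπ h w))

theorem comparison_obj_eq_iff (adj : L ⊣ G) {A : adj.toMonad.Algebra} {B : D} :
    (Monad.comparison adj).obj B = A ↔
      ∃ h : L.obj A.A ⟶ B, IsLift G (A.a : G.obj (L.obj A.A) ⟶ A.A) h := by
  constructor
  · rintro rfl
    exact ⟨adj.counit.app B, rfl, Category.comp_id _⟩
  · obtain ⟨A, a, unit, assoc⟩ := A
    rintro ⟨h : L.obj A ⟶ B, e : G.obj B = A, ha⟩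
    subst e
    obtain rfl : G.map h = a := (Category.comp_id _).symm.trans ha
    have h_eq : h = adj.counit.app B := (adj.homEquiv _ _).injective <| by
      rw [adj.homEquiv_unit, adj.homEquiv_unit, adj.right_triangle_components]
      exact unit
    subst h_eq
    rfl

variable (hG : CreatesSplitCoequalizers G) (adj : L ⊣ G)
include hG

theorem CreatesSplitCoequalizers.isColimit_counit (B : D) :
    ∃ w : L.map (G.map (adj.counit.app B)) ≫ adj.counit.app B =
        adj.counit.app (L.obj (G.obj B)) ≫ adj.counit.app B,
      Nonempty (IsColimit (Cofork.ofπ (adj.counit.app B) w)) :=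
  (hG (Monad.beckSplitCoequalizer ((Monad.comparison adj).obj B))).2 _
    ⟨rfl, Category.comp_id _⟩

theorem CreatesSplitCoequalizers.comparison_faithful : (Monad.comparison adj).Faithful := by
  have (B : D) : Epi (adj.counit.app B) := by
    obtain ⟨_, ⟨hB⟩⟩ := hG.isColimit_counit adj B
    exact Cofork.IsColimit.epi hB
  have := adj.faithful_R_of_epi_counit_app
  infer_instance

theorem CreatesSplitCoequalizers.comparison_full : (Monad.comparison adj).Full where
  map_surjective {X Y} φ := by
    obtain ⟨w, ⟨hX⟩⟩ := hG.isColimit_counit adj X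
    let φ₀ : G.obj X ⟶ G.obj Y := φ.f
    have hφ : G.map (adj.counit.app X) ≫ φ₀ = G.map (L.map φ₀) ≫ G.map (adj.counit.app Y) :=
      φ.h.symm
    have hk : L.map (G.map (adj.counit.app X)) ≫ L.map φ₀ ≫ adj.counit.app Y =
        adj.counit.app _ ≫ L.map φ₀ ≫ adj.counit.app Y := by
      rw [← L.map_comp_assoc, hφ]
      simp
    obtain ⟨k, hk⟩ := Cofork.IsColimit.desc' hX _ hk
    refine ⟨k, Monad.Algebra.Hom.ext ?_⟩
    have : IsSplitEpi (G.map (adj.counit.app X)) := ⟨⟨⟨_, adj.right_triangle_components X⟩⟩⟩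
    refine (cancel_epi (G.map (adj.counit.app X))).1 ?_
    calc G.map (adj.counit.app X) ≫ G.map k
        = G.map (adj.counit.app X ≫ k) := (G.map_comp _ _).symm
      _ = G.map (L.map φ₀ ≫ adj.counit.app Y) := congrArg G.map hk
      _ = G.map (adj.counit.app X) ≫ φ₀ := (G.map_comp _ _).trans hφ.symm

theorem CreatesSplitCoequalizers.isStrictlyMonadic [G.IsRightAdjoint] : IsStrictlyMonadic G :=
  ⟨inferInstance, fun _ adj =>
    { faithful := hG.comparison_faithful adj
      full := hG.comparison_full adj
      bijective_obj := Function.bijective_iff_existsUnique _ |>.2 fun A => by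
        simp only [comparison_obj_eq_iff]
        exact (hG (f := _) (g := adj.counit.app _) (Monad.beckSplitCoequalizer A)).1 }⟩

end Beck

section QCat

variable {Q : Type u} [Quantaloid Q]

theorem eqToHom_conj_le_iff {p p' q q' : Q} (hp : p = p') (hq : q = q') {u : p' ⟶ q'}
    {v : p ⟶ q} : eqToHom hp ≫ u ≫ eqToHom hq.symm ≤ v ↔ u ≤ eqToHom hp.symm ≫ v ≫ eqToHom hq := by
  subst hp hq
  simp

theorem QCat.hom_congr (X : QCat Q) {x x' y y' : X.carrier} (hx : x = x') (hy : y = y') :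
    X.hom x y = eqToHom (congrArg X.type hx) ≫ X.hom x' y' ≫
      eqToHom (congrArg X.type hy).symm := by
  subst hx hy
  simp

theorem QCat.eq_of_hom_eq {S : Type u} {τ : S → Q} {α β : ∀ x y, τ x ⟶ τ y} {hα hα' hβ hβ'}
    (h : ∀ x y, α x y = β x y) : (⟨S, τ, α, hα, hα'⟩ : QCat Q) = ⟨S, τ, β, hβ, hβ'⟩ := by
  obtain rfl : α = β := funext₂ h
  rfl

theorem QCat.le_of_eq (X : QCat Q) {x y : X.carrier} (h : x = y) : X.le x y := h ▸ X.le_refl x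

theorem QCat.hom_eq_of_section {X Y : QCat Q} {s : X ⟶ Y} {r : Y ⟶ X}
    (h : ∀ x, r.map (s.map x) = x) (x x' : X.carrier) :
    X.hom x x' = eqToHom (s.type_map x).symm ≫ Y.hom (s.map x) (s.map x') ≫
      eqToHom (s.type_map x') := by
  refine (s.hom_le x x').antisymm ((eqToHom_conj_le_iff _ (s.type_map x').symm).2 ?_)
  refine (r.hom_le _ _).trans_eq ?_
  rw [X.hom_congr (h x) (h x')]
  simp

theorem presheafCat_ext {X : QCat Q} {μ ν : (presheafCat X).carrier} (h : μ.1 = ν.1)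
    (h' : ∀ x, μ.2.val x ≫ eqToHom h = ν.2.val x) : μ = ν := by
  obtain ⟨p, μ⟩ := μ
  obtain ⟨q, ν⟩ := ν
  change p = q at h
  subst h
  exact congrArg (Sigma.mk p) <| Presheaf.ext <| funext fun x =>
    (Category.comp_id _).symm.trans (h' x)

section Adjoint

variable {X Y Z : QCat Q} {f : X ⟶ Y} {g : Y ⟶ X}

theorem IsAdjoint.map_map_map (h : IsAdjoint f g) (hY : Y.IsSeparated) (x : X.carrier) :
    f.map (g.map (f.map x)) = f.map x :=
  hY _ _ (h.2 _) (f.mono (h.1 x))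

theorem IsAdjoint.map_map_of_surjective (h : IsAdjoint f g) (hY : Y.IsSeparated)
    (hf : Function.Surjective f.map) (y : Y.carrier) : f.map (g.map y) = y := by
  obtain ⟨x, rfl⟩ := hf y
  exact h.map_map_map hY x

theorem IsAdjoint.left_unique {f' : X ⟶ Y} (h : IsAdjoint f g) (h' : IsAdjoint f' g)
    (hY : Y.IsSeparated) : f = f' :=
  QCat.hom_ext fun x => hY _ _ (h.le_iff.2 (h'.1 x)) (h'.le_iff.2 (h.1 x))

theorem IsAdjoint.isComplete (h : IsAdjoint f g) (hfg : ∀ y, f.map (g.map y) = y)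
    (hX : X.IsComplete) : Y.IsComplete := by
  obtain ⟨s, hs⟩ := hX
  have yoneda_eq : (g ≫ yoneda X) ≫ inverseImage g = yoneda Y :=
    QCat.hom_ext fun y => presheafCat_ext (g.type_map y) fun y' => by
      simp [QCat.hom_eq_of_section hfg y' y]
  exact ⟨_, yoneda_eq ▸ (directImage_isAdjoint g).comp (hs.comp h)⟩

theorem IsAdjoint.of_retraction {k : X ⟶ Z} {m : Z ⟶ X} (h : IsAdjoint k m)
    (hfg : ∀ y, f.map (g.map y) = y) (hkf : ∀ x, k.map (g.map (f.map x)) = k.map x) :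
    IsAdjoint (g ≫ k) (m ≫ f) :=
  ⟨fun y => Y.le_trans (Y.le_of_eq (hfg y).symm) (f.mono (h.1 _)),
    fun z => Z.le_trans (Z.le_of_eq (hkf _)) (h.2 z)⟩

end Adjoint

/-- The `Q`-category on a typed set `τ : S → Q` whose hom is pulled back from `Y` along a
type-preserving map `c`. -/
def QCat.induced (Y : QCat Q) {S : Type u} (τ : S → Q) (c : S → Y.carrier)
    (hc : ∀ s, Y.type (c s) = τ s) : QCat Q where
  carrier := S
  type := τ
  hom s t := eqToHom (hc s).symm ≫ Y.hom (c s) (c t) ≫ eqToHom (hc t)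
  id_le s := by
    rw [← eqToHom_conj_le_iff (hc s) (hc s)]
    simpa using Y.id_le (c s)
  comp_le s t u := by
    rw [← eqToHom_conj_le_iff (hc s) (hc u)]
    simpa using Y.comp_le (c s) (c t) (c u)

/-- The fully faithful `Q`-functor `c : Y.induced τ c hc ⟶ Y`. -/
def QCat.inducedFunctor (Y : QCat Q) {S : Type u} (τ : S → Q) (c : S → Y.carrier)
    (hc : ∀ s, Y.type (c s) = τ s) : Y.induced τ c hc ⟶ Y where
  map := c
  type_map := hc
  hom_le _ _ := le_rfl

end QCat

section Creation

variable {Q : Type u} [InvolutiveQuantaloid Q]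

open Limits
open QEnriched.InvolutiveQuantaloid (dag)

theorem eqToHom_conj_inf_dag {p p' q q' : Q} (hp : p = p') (hq : q = q') (u : p' ⟶ q')
    (v : q' ⟶ p') : eqToHom hp ≫ (u ⊓ dag v) ≫ eqToHom hq.symm =
      eqToHom hp ≫ u ≫ eqToHom hq.symm ⊓ dag (eqToHom hq ≫ v ≫ eqToHom hp.symm) := by
  subst hp hq
  simp

theorem SymCat.eqToHom_map {X Y : SymCat Q} (e : X = Y) (x : X.obj.carrier) :
    HEq ((eqToHom e).hom.map x) x := by
  subst e
  rfl

theorem SymCat.comp_eq_id_map {X Y : SymCat Q} {s : X ⟶ Y} {r : Y ⟶ X} (h : s ≫ r = 𝟙 X)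
    (x : X.obj.carrier) : r.hom.map (s.hom.map x) = x :=
  congrArg (fun φ : X ⟶ X => φ.hom.map x) h

theorem SymCat.congr_map {X Y : SymCat Q} {φ ψ : X ⟶ Y} (h : φ = ψ) (x : X.obj.carrier) :
    φ.hom.map x = ψ.hom.map x := h ▸ rfl

/-- Largest elements in the fibres of `q : Y_s ⟶ Z`, given `Q`-functorially both on `Z` and on `Y`:
`top z` is the largest element of `Y` over `z`, and `closure y` is the largest one over `q y`. -/
structure FibreClosure {Y : QCat Q} {Z : SymCat Q} (q : symmetrize Y ⟶ Z) where
  top : Z.obj ⟶ Y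
  closure : Y ⟶ Y
  map_top : ∀ z, q.hom.map (top.map z) = z
  closure_map : ∀ y, closure.map y = top.map (q.hom.map y)
  le_closure : ∀ y, Y.le y (closure.map y)

namespace FibreClosure

variable {Y : QCat Q} {Z : SymCat Q} {q : symmetrize Y ⟶ Z} (c : FibreClosure q)

/-- The typed set of `Z` with the hom of the largest elements of the fibres: the quotient of `Y`
by the fibres of `q`. -/
abbrev quotient : QCat Q := Y.induced Z.obj.type c.top.map c.top.type_map

/-- The map `q` as a `Q`-functor from `Y` to its quotient. -/
def proj : Y ⟶ c.quotient where
  map := q.hom.map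
  type_map := q.hom.type_map
  hom_le y y' := calc
    Y.hom y y'
    _ ≤ eqToHom _ ≫ Y.hom (c.closure.map y) (c.closure.map y') ≫ eqToHom _ := c.closure.hom_le y y'
    _ = eqToHom (q.hom.type_map y).symm ≫ (eqToHom (c.top.type_map _).symm ≫
          Y.hom (c.top.map (q.hom.map y)) (c.top.map (q.hom.map y')) ≫
          eqToHom (c.top.type_map _)) ≫ eqToHom (q.hom.type_map y') := by
      rw [Y.hom_congr (c.closure_map y) (c.closure_map y')]
      simp

/-- The embedding of the quotient into `Y` as the set of largest elements of the fibres. -/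
def incl : c.quotient ⟶ Y := Y.inducedFunctor _ _ _

theorem proj_incl_map (z : Z.obj.carrier) : c.proj.map (c.incl.map z) = z := c.map_top z

theorem proj_isAdjoint : IsAdjoint c.proj c.incl :=
  ⟨fun y => Y.le_trans (c.le_closure y) (Y.le_of_eq (c.closure_map y)),
    fun z => c.quotient.le_of_eq (c.proj_incl_map z)⟩

theorem quotient_isSeparated (hY : Y.IsSeparated) : c.quotient.IsSeparated := fun _ _ h h' =>
  Function.LeftInverse.injective c.proj_incl_map (hY _ _ (c.incl.mono h) (c.incl.mono h'))

theorem quotient_isComplete (hY : Y.IsComplete) : c.quotient.IsComplete :=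
  c.proj_isAdjoint.isComplete c.proj_incl_map hY

theorem symmetrize_quotient : symmetrize c.quotient = Z := by
  have hom_eq (z z' : Z.obj.carrier) :=
    QCat.hom_eq_of_section (s := toSymmetrize Z.property c.top) (r := q.hom) c.map_top z z'
  refine ObjectProperty.FullSubcategory.ext (QCat.eq_of_hom_eq fun z z' => ?_)
  exact ((hom_eq z z').trans (eqToHom_conj_inf_dag _ _ _ _)).symm

end FibreClosure

theorem QSup.eq_of_eqToHom {X Y : QSup Q} (e : (Us Q).obj X = (Us Q).obj Y) {k : X ⟶ Y} {k' : Y ⟶ X}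
    (hk : (Us Q).map k = eqToHom e) (hk' : (Us Q).map k' = eqToHom e.symm) : X = Y := by
  obtain ⟨⟨S, τ, α, _, _⟩, _, _⟩ := X
  obtain ⟨⟨S', τ', β, _, _⟩, _, _⟩ := Y
  injection e with e'
  injection e' with hS hτ
  subst hS
  obtain rfl := eq_of_heq hτ
  have k_map (x : S) : k.toQFunctor.map x = x :=
    (SymCat.congr_map hk x).trans (eq_of_heq (SymCat.eqToHom_map e x))
  have k'_map (x : S) : k'.toQFunctor.map x = x :=
    (SymCat.congr_map hk' x).trans (eq_of_heq (SymCat.eqToHom_map e.symm x))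
  have hom_eq (x y : S) : α x y = β x y := by
    refine (QCat.hom_eq_of_section (s := k.toQFunctor) (r := k'.toQFunctor)
      (fun x => (k'_map _).trans (k_map x)) x y).trans ?_
    rw [QCat.hom_congr _ (k_map x) (k_map y)]
    simp
  obtain rfl : α = β := funext₂ hom_eq
  rfl

instance : (Us Q).Faithful where
  map_injective h := QSup.hom_ext fun x => SymCat.congr_map h x

theorem QSup.exists_lift_of_surjective {X Y W : QSup Q} {h : X ⟶ Y}
    (hs : Function.Surjective h.toQFunctor.map) {k : X ⟶ W} {φ : (Us Q).obj Y ⟶ (Us Q).obj W}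
    (hφ : (Us Q).map h ≫ φ = (Us Q).map k) : ∃ k' : Y ⟶ W, (Us Q).map k' = φ := by
  obtain ⟨r, hr⟩ := h.isLeftAdjoint
  obtain ⟨m, hm⟩ := k.isLeftAdjoint
  have h_r (y) : h.toQFunctor.map (r.map y) = y := hr.map_map_of_surjective Y.separated hs y
  have φ_h (x) : φ.hom.map (h.toQFunctor.map x) = k.toQFunctor.map x := SymCat.congr_map hφ x
  have k_r (y) : k.toQFunctor.map (r.map y) = φ.hom.map y := by rw [← φ_h, h_r]
  refine ⟨⟨_, _, hm.of_retraction h_r fun x => ?_⟩, ?_⟩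
  · rw [k_r, φ_h]
  · ext1
    exact QCat.hom_ext k_r

section SplitCoequalizer

variable {X Y : QSup Q} {f g : X ⟶ Y} {f' g' : Y.toQCat ⟶ X.toQCat} {Z : SymCat Q}
  {q : (Us Q).obj Y ⟶ Z}

theorem map_closure_of_isSplitCoequalizer (hf : IsAdjoint f.toQFunctor f')
    (hg : IsAdjoint g.toQFunctor g') (hq : IsSplitCoequalizer ((Us Q).map f) ((Us Q).map g) q)
    (y : Y.toQCat.carrier) :
    q.hom.map ((g' ≫ f.toQFunctor ≫ f' ≫ g.toQFunctor).map y) = q.hom.map y := by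
  have q_f (x) : q.hom.map (f.toQFunctor.map x) = q.hom.map (g.toQFunctor.map x) :=
    SymCat.congr_map hq.condition x
  have g_g' (y) : g.toQFunctor.map (g'.map y) = y := hg.map_map_of_surjective Y.separated
    (fun y => ⟨_, SymCat.comp_eq_id_map hq.leftSection_bottom y⟩) y
  simp only [QCat.comp_map]
  rw [← q_f, hf.map_map_map Y.separated, q_f, g_g']

theorem le_closure_of_isSplitCoequalizer (hf : IsAdjoint f.toQFunctor f')
    (hg : IsAdjoint g.toQFunctor g') (hq : IsSplitCoequalizer ((Us Q).map f) ((Us Q).map g) q)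
    {y y' : Y.toQCat.carrier} (h : q.hom.map y = q.hom.map y') :
    Y.toQCat.le y ((g' ≫ f.toQFunctor ≫ f' ≫ g.toQFunctor).map y') := by
  let t := hq.leftSection.hom
  have g_t (y) : g.toQFunctor.map (t.map y) = y :=
    SymCat.comp_eq_id_map hq.leftSection_bottom y
  have f_t (y) : f.toQFunctor.map (t.map y) = hq.rightSection.hom.map (q.hom.map y) :=
    SymCat.congr_map hq.leftSection_top y
  have f_t_eq : f.toQFunctor.map (t.map y) = f.toQFunctor.map (t.map y') := by rw [f_t, f_t, h]
  have t_le : X.toQCat.le (t.map y') (g'.map y') := hg.le_iff.1 (Y.toQCat.le_of_eq (g_t y'))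
  have t_le_adjoint : X.toQCat.le (t.map y) (f'.map (f.toQFunctor.map (g'.map y'))) :=
    hf.le_iff.1 (Y.toQCat.le_trans (Y.toQCat.le_of_eq f_t_eq) (f.toQFunctor.mono t_le))
  exact Y.toQCat.le_trans (Y.toQCat.le_of_eq (g_t y).symm) (g.toQFunctor.mono t_le_adjoint)

/-- The fibre closure of a split coequalizer `q` of `f_s` and `g_s` in `Q`-**SymCat**, where
`f ⊣ f'` and `g ⊣ g'`: the closure is `y ↦ g f' f g' y`. -/
def FibreClosure.ofSplitCoequalizer (hf : IsAdjoint f.toQFunctor f')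
    (hg : IsAdjoint g.toQFunctor g') (hq : IsSplitCoequalizer ((Us Q).map f) ((Us Q).map g) q) :
    FibreClosure q where
  top := hq.rightSection.hom ≫ fromSymmetrize Y.toQCat ≫ g' ≫ f.toQFunctor ≫ f' ≫ g.toQFunctor
  closure := g' ≫ f.toQFunctor ≫ f' ≫ g.toQFunctor
  map_top z := (map_closure_of_isSplitCoequalizer hf hg hq _).trans
    (SymCat.comp_eq_id_map hq.rightSection_π z)
  closure_map y := by
    have map_eq := map_closure_of_isSplitCoequalizer hf hg hq
    have q_s : q.hom.map (hq.rightSection.hom.map (q.hom.map y)) = q.hom.map y :=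
      SymCat.comp_eq_id_map hq.rightSection_π _
    exact Y.separated _ _
      (le_closure_of_isSplitCoequalizer hf hg hq ((map_eq y).trans q_s.symm))
      (le_closure_of_isSplitCoequalizer hf hg hq ((map_eq _).trans q_s))
  le_closure _ := le_closure_of_isSplitCoequalizer hf hg hq rfl

end SplitCoequalizer

theorem Us_exists_lift {X Y : QSup Q} {f g : X ⟶ Y} {Z : SymCat Q} {q : (Us Q).obj Y ⟶ Z}
    (hq : IsSplitCoequalizer ((Us Q).map f) ((Us Q).map g) q) :
    ∃ B : QSup Q, ∃ h : Y ⟶ B, IsLift (Us Q) q h := by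
  obtain ⟨_, hf⟩ := f.isLeftAdjoint
  obtain ⟨_, hg⟩ := g.isLeftAdjoint
  let c := FibreClosure.ofSplitCoequalizer hf hg hq
  refine ⟨⟨c.quotient, c.quotient_isSeparated Y.separated, c.quotient_isComplete Y.complete⟩,
    ⟨c.proj, _, c.proj_isAdjoint⟩, c.symmetrize_quotient, ?_⟩
  ext1
  exact QCat.hom_ext fun y => eq_of_heq (SymCat.eqToHom_map c.symmetrize_quotient _)

theorem Us_lift_unique {Y B B' : QSup Q} {Z : SymCat Q} {q : (Us Q).obj Y ⟶ Z}
    (hq : Function.Surjective q.hom.map) {h : Y ⟶ B} {h' : Y ⟶ B'} (hB : IsLift (Us Q) q h)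
    (hB' : IsLift (Us Q) q h') : B = B' := by
  obtain ⟨rfl, hB⟩ := hB
  obtain ⟨e, hB'⟩ := hB'
  obtain rfl : (Us Q).map h = q := (Category.comp_id _).symm.trans hB
  have hB'_symm : (Us Q).map h ≫ eqToHom e.symm = (Us Q).map h' := by
    rw [← hB', Category.assoc, eqToHom_trans, eqToHom_refl, Category.comp_id]
  have hq' : Function.Surjective h'.toQFunctor.map := by
    intro z
    obtain ⟨y, hy⟩ := hq ((eqToHom e).hom.map z)
    refine ⟨y, ?_⟩
    calc ((Us Q).map h').hom.map y
        = (eqToHom e.symm).hom.map (((Us Q).map h).hom.map y) :=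
          (SymCat.congr_map hB'_symm y).symm
      _ = (eqToHom e.symm).hom.map ((eqToHom e).hom.map z) := congrArg _ hy
      _ = z := SymCat.comp_eq_id_map ((eqToHom_trans e e.symm).trans (eqToHom_refl _ _)) z
  obtain ⟨k, hk⟩ := QSup.exists_lift_of_surjective hq hB'_symm
  obtain ⟨k', hk'⟩ := QSup.exists_lift_of_surjective hq' hB'
  exact QSup.eq_of_eqToHom e.symm hk hk'

theorem Us_isColimit_of_isSplitCoequalizer {X Y B : QSup Q} {f g : X ⟶ Y} {h : Y ⟶ B}
    (hs : IsSplitCoequalizer ((Us Q).map f) ((Us Q).map g) ((Us Q).map h)) :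
    ∃ w : f ≫ h = g ≫ h, Nonempty (IsColimit (Cofork.ofπ h w)) := by
  have w : f ≫ h = g ≫ h := (Us Q).map_injective <| by
    rw [(Us Q).map_comp, (Us Q).map_comp, hs.condition]
  have : IsSplitEpi ((Us Q).map h) := ⟨⟨_, hs.rightSection_π⟩⟩
  have : Epi h := (Us Q).epi_of_epi_map inferInstance
  have h_surjective : Function.Surjective h.toQFunctor.map :=
    fun z => ⟨_, SymCat.comp_eq_id_map hs.rightSection_π z⟩
  refine ⟨w, ⟨Cofork.IsColimit.ofExistsUnique fun c => ?_⟩⟩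
  have hc : (Us Q).map f ≫ (Us Q).map c.π = (Us Q).map g ≫ (Us Q).map c.π := by
    rw [← (Us Q).map_comp, c.condition, (Us Q).map_comp]
  obtain ⟨φ, hφ⟩ := Cofork.IsColimit.desc' hs.isCoequalizer _ hc
  obtain ⟨k, rfl⟩ := QSup.exists_lift_of_surjective h_surjective hφ
  have hk : h ≫ k = c.π := (Us Q).map_injective (((Us Q).map_comp _ _).trans hφ)
  exact ⟨k, hk, fun k' hk' => (cancel_epi h).1 (hk'.trans hk.symm)⟩

theorem Us_createsSplitCoequalizers : CreatesSplitCoequalizers (Us Q) := by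
  intro X Y f g Z q hq
  constructor
  · obtain ⟨B, h, hB⟩ := Us_exists_lift hq
    refine ⟨B, ⟨h, hB⟩, ?_⟩
    rintro B' ⟨h', hB'⟩
    exact Us_lift_unique (fun z => ⟨_, SymCat.comp_eq_id_map hq.rightSection_π z⟩) hB' hB
  · rintro B h ⟨rfl, hB⟩
    obtain rfl : (Us Q).map h = q := (Category.comp_id _).symm.trans hB
    exact Us_isColimit_of_isSplitCoequalizer hq

theorem isStrictlyMonadic_Us : IsStrictlyMonadic (Us Q) :=
  have := (psAdj Q).isRightAdjoint
  Us_createsSplitCoequalizers.isStrictlyMonadic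

instance comparison_isIso : (Monad.comparison (psAdj Q)).IsIso :=
  isStrictlyMonadic_Us.2 _ (psAdj Q)

end Creation

section Multiplication

variable {Q : Type u}

theorem Pc_obj_sup [Quantaloid Q] (X : QCat Q) : ((Pc Q).obj X).sup = presheafSup X :=
  ((Pc Q).obj X).sup_isAdjoint.left_unique (presheafSup_isAdjoint X) (presheafCat_isSeparated X)

variable [InvolutiveQuantaloid Q]

theorem psAdj_counit_app (X : QSup Q) :
    ((psAdj Q).counit.app X).toQFunctor = directImage (fromSymmetrize X.toQCat) ≫ X.sup := by
  simp only [psAdj, Adjunction.comp_counit_app]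
  rfl

theorem psMonad_μ_app_map (X : SymCat Q)
    (Φ : (presheafCat (symmetrize (presheafCat X.obj)).obj).carrier) :
    ((psMonad Q).μ.app X).hom.map Φ =
      (presheafSup X.obj).map ((directImage (fromSymmetrize (presheafCat X.obj))).map Φ) := by
  rw [← Pc_obj_sup]
  exact congrArg (fun φ => QFunctor.map φ Φ) (psAdj_counit_app ((Ps Q).obj X))

theorem presheafSup_directImage_fromSymmetrize_val (X : QCat Q)
    (Φ : (presheafCat (symmetrize (presheafCat X)).obj).carrier) (x : X.carrier) :
    ((presheafSup X).map ((directImage (fromSymmetrize (presheafCat X))).map Φ)).2.val x =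
      ⨆ μ : (presheafCat X).carrier, μ.2.val x ≫ Φ.2.val μ := by
  refine le_antisymm (iSup_le fun μ => ?_) (iSup_mono fun μ => comp_mono le_rfl ?_)
  · refine (comp_iSup _ _).trans_le (iSup_mono fun ν => ?_)
    calc μ.2.val x ≫ (presheafCat X).hom μ ν ≫ 𝟙 _ ≫ Φ.2.val ν
        = (μ.2.val x ≫ (presheafCat X).hom μ ν) ≫ Φ.2.val ν := by
          rw [Category.id_comp, Category.assoc]
      _ ≤ ν.2.val x ≫ Φ.2.val ν := comp_mono (presheafCat_comp_hom μ ν x) le_rfl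
  · calc Φ.2.val μ = 𝟙 _ ≫ 𝟙 _ ≫ Φ.2.val μ := by rw [Category.id_comp, Category.id_comp]
      _ ≤ (presheafCat X).hom μ μ ≫ 𝟙 _ ≫ Φ.2.val μ :=
        comp_mono ((presheafCat X).id_le μ) le_rfl
      _ ≤ _ := le_iSup (fun ν => (presheafCat X).hom μ ν ≫ 𝟙 _ ≫ Φ.2.val ν) μ

end Multiplication

section QSet

variable {V : Type u} [Monoid V] [CompleteLattice V] [StarMul V] [IsInvolutiveQuantale V]

theorem QSet.sim_self (X : QSet V) (x : X.obj.carrier) : X.sim x x = (X.obj.type x).val :=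
  le_antisymm ((X.obj.hom x x).le_inf.trans inf_le_left) (X.obj.id_le x)

namespace DStar

theorem val_comp {p q r : DStar V} (d : p ⟶ q) (e : q ⟶ r) :
    Hom.val (d ≫ e) = (q.val ⇨ₗ Hom.val e) * Hom.val d := rfl

theorem val_hom_iSup {p q : DStar V} {ι : Sort*} (f : ι → (p ⟶ q)) :
    Hom.val (⨆ i, f i) = ⨆ i, Hom.val (f i) := val_iSup f

theorem val_eqToHom_comp {p p' q : DStar V} (h : p = p') (d : p' ⟶ q) :
    Hom.val (eqToHom h ≫ d) = Hom.val d := by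
  subst h
  simp

end DStar

theorem isPotentialSubset_of_presheaf (X : QSet V) {q : DStar V} (μ : Presheaf X.obj q) :
    IsPotentialSubset X (fun x => DStar.Hom.val (μ.val x)) q.val where
  herm := q.herm
  le_inf x := by rw [X.sim_self]; exact (μ.val x).le_inf
  left_div x := by rw [X.sim_self]; exact (μ.val x).left_div
  right_div x := (μ.val x).right_div
  dist_eq x y := by rw [X.sim_self]; exact DStar.comp_eq (X.obj.hom x y) (μ.val y)
  dist_le x y := by rw [X.sim_self]; exact μ.dist y x

/-- The presheaf given by a potential `V`-subset. -/
def IsPotentialSubset.toPresheaf {X : QSet V} {m : X.obj.carrier → V} {q : V}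
    (h : IsPotentialSubset X m q) : Presheaf X.obj (⟨q, h.herm⟩ : DStar V) where
  val x :=
    { val := m x
      le_inf := by rw [← X.sim_self]; exact h.le_inf x
      left_div := by rw [← X.sim_self]; exact h.left_div x
      right_div := h.right_div x }
  dist x x' :=
    (congrArg (fun v => (v ⇨ₗ m x) * X.sim x' x) (X.sim_self x)).ge.trans (h.dist_le x' x)

theorem isPotentialSubset_iff (X : QSet V) (m : X.obj.carrier → V) (q : V) :
    IsPotentialSubset X m q ↔ ∃! μ : (presheafCat X.obj).carrier,
      μ.1.val = q ∧ ∀ x, DStar.Hom.val (μ.2.val x) = m x := by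
  constructor
  · intro h
    refine ⟨⟨⟨q, h.herm⟩, h.toPresheaf⟩, ⟨rfl, fun _ => rfl⟩, ?_⟩
    rintro ⟨⟨q', hq'⟩, μ⟩ ⟨rfl, hμ⟩
    exact congrArg (Sigma.mk _) (Presheaf.ext (funext fun x => DStar.Hom.ext (hμ x)))
  · rintro ⟨μ, ⟨rfl, hμ⟩, -⟩
    obtain rfl : _ = m := funext hμ
    exact isPotentialSubset_of_presheaf X μ.2

theorem directImage_val (X Y : QSet V) (f : X ⟶ Y) (μ : (presheafCat X.obj).carrier)
    (y : Y.obj.carrier) :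
    DStar.Hom.val (((directImage f.hom).map μ).2.val y) =
      ⨆ x, (X.sim x x ⇨ₗ DStar.Hom.val (μ.2.val x)) * Y.sim y (f.hom.map x) := by
  refine (DStar.val_hom_iSup _).trans (iSup_congr fun x => ?_)
  rw [DStar.val_comp, DStar.val_eqToHom_comp, X.sim_self,
    ← congrArg DStar.val (f.hom.type_map x)]

end QSet

end QEnriched

theorem theorem3p10 :
    (∀ (Q : Type u) [InvolutiveQuantaloid Q],
      -- `U_s` is strictly monadic, and `P_s ⊣ U_s` exhibits this: the comparison functor is an
      -- isomorphism from `Q`-**Sup** onto the Eilenberg–Moore category of the monad `P_s`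
      IsStrictlyMonadic (Us Q) ∧
      (Monad.comparison (psAdj Q)).IsIso ∧
      Nonempty (IsoCat (psMonad Q).Algebra (QSup Q)) ∧
      -- the monad `P_s`: objects, maps, unit and multiplication
      (∀ X : SymCat Q, (psMonad Q).obj X = symmetrize (presheafCat X.obj)) ∧
      (∀ (X Y : SymCat Q) (f : X ⟶ Y) (μ : (presheafCat X.obj).carrier),
        ((psMonad Q).map f).hom.map μ = (directImage f.hom).map μ) ∧
      (∀ (X : SymCat Q) (x : X.obj.carrier),
        ((psMonad Q).η.app X).hom.map x = (yoneda X.obj).map x) ∧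
      (∀ (X : SymCat Q) (Φ : (presheafCat (symmetrize (presheafCat X.obj)).obj).carrier)
        (Ψ : (presheafCat X.obj).carrier), Ψ = ((psMonad Q).μ.app X).hom.map Φ →
        ∃ h : Ψ.1 = Φ.1, ∀ x, Ψ.2.val x ≫ eqToHom h =
          ⨆ μ : (presheafCat X.obj).carrier, μ.2.val x ≫ Φ.2.val μ)) ∧
    (∀ (V : Type u) [Monoid V] [CompleteLattice V] [StarMul V] [IsInvolutiveQuantale V],
      -- the case `Q = D_*(V)`
      IsStrictlyMonadic (Us (DStar V) : QSup (DStar V) ⥤ QSet V) ∧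
      Nonempty (IsoCat (powersetMonad V).Algebra (QSup (DStar V))) ∧
      -- elements of the powerset are the potential subsets
      (∀ (X : QSet V) (m : X.obj.carrier → V) (q : V), IsPotentialSubset X m q ↔
        ∃! μ : ((powersetMonad V).obj X).obj.carrier,
          (((powersetMonad V).obj X).obj.type μ).val = q ∧
          ∀ x, DStar.Hom.val (Presheaf.val (Sigma.snd μ) x) = m x) ∧
      -- direct images
      (∀ (X Y : QSet V) (f : X ⟶ Y) (μ : (presheafCat X.obj).carrier)
        (ν : (presheafCat Y.obj).carrier), ν = ((powersetMonad V).map f).hom.map μ →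
        ν.1 = μ.1 ∧ ∀ y, DStar.Hom.val (ν.2.val y) =
          ⨆ x, (X.sim x x ⇨ₗ DStar.Hom.val (μ.2.val x)) * Y.sim y (f.hom.map x)) ∧
      -- unit
      (∀ (X : QSet V) (x : X.obj.carrier) (ν : (presheafCat X.obj).carrier),
        ν = ((powersetMonad V).η.app X).hom.map x →
        ν.1.val = X.sim x x ∧ ∀ y, DStar.Hom.val (ν.2.val y) = X.sim y x) ∧
      -- multiplication
      (∀ (X : QSet V) (Φ : (presheafCat (symmetrize (presheafCat X.obj)).obj).carrier)
        (ν : (presheafCat X.obj).carrier), ν = ((powersetMonad V).μ.app X).hom.map Φ →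
        ν.1 = Φ.1 ∧ ∀ x, DStar.Hom.val (ν.2.val x) =
          ⨆ μ : (presheafCat X.obj).carrier,
            (μ.1.val ⇨ₗ DStar.Hom.val (Φ.2.val μ)) * DStar.Hom.val (μ.2.val x))) := by
  refine ⟨fun Q _ => ⟨isStrictlyMonadic_Us, comparison_isIso,
    ⟨(Monad.comparison (psAdj Q)).asIsomorphism.symm⟩, fun _ => rfl, fun _ _ _ _ => rfl,
    fun _ _ => rfl, ?_⟩, fun V _ _ _ _ => ⟨isStrictlyMonadic_Us,
    ⟨(Monad.comparison (psAdj (DStar V))).asIsomorphism.symm⟩, isPotentialSubset_iff, ?_, ?_, ?_⟩⟩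
  · rintro X Φ _ rfl
    rw [psMonad_μ_app_map]
    exact ⟨rfl, fun x => (Category.comp_id _).trans
      (presheafSup_directImage_fromSymmetrize_val X.obj Φ x)⟩
  · rintro X Y f μ _ rfl
    exact ⟨rfl, directImage_val X Y f μ⟩
  · rintro X x _ rfl
    exact ⟨(X.sim_self x).symm, fun _ => rfl⟩
  · rintro X Φ _ rfl
    rw [psMonad_μ_app_map]
    exact ⟨rfl, fun x =>
      (congrArg DStar.Hom.val (presheafSup_directImage_fromSymmetrize_val X.obj Φ x)).trans
        (DStar.val_hom_iSup _)⟩
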